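/- A Brouwerian algebra is an algebra $\langle A;\to,\wedge,\vee,\top\rangle$ such that $\langle A;\wedge,\vee\rangle$ is a lattice with greatest element $\top$ and $a\wedge b\le c \iff a\le b\to c$ for all $a,b,c\in A$; its filters are its non-empty lattice filters. Let $\mathrm{Pr}\,A$ be the set of all filters $F$ of $A$ whose complement is closed under $\vee$ (including the improper filter $A$), ordered by inclusion. If $F\in \mathrm{Pr}\,A$ and $F\neq A$, the depth of $F$ is the positive integer $n$ such that the poset $\mathrm{Pr}\,A\smallsetminus\{A\}$ contains a chain $F=F_1\subsetneq\dots\subsetneq F_n$ but no chain $F=G_1\subsetneq\dots\subsetneq G_{n+1}$, and it is $\infty$ if there is no such $n$; the depth of the improper filter $A$ is $0$. The depth of $A$ is the supremum of the depths of the elements of $\mathrm{Pr}\,A$. Define terms $h_0:=y$ and $h_n:=x_n\vee(x_n\to h_{n-1})$ for $n>0$. Let $n$ be a non-negative integer. 1. A Brouwerian algebra $A$ has depth at most $n$ if and only if it satisfies the equation $h_n\approx\top$. 2. Consequently, the class $\mathsf{BRA}_n$ of all Brouwerian algebras of depth at most $n$ is a variety: among all algebras of the signature $\to,\wedge,\vee,\top$,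 it is a non-empty class that is closed under homomorphic images, subalgebras and direct products, and it is the class of all models of some set of equations. 3. A Brouwerian algebra $A$ satisfies $h_n\approx\top$ if and only if $A_\bot$ satisfies $h_{n+1}\approx\top$, where $A_\bot$ is the unique Heyting algebra whose lattice reduct is obtained by adding a new least element $\bot$ to $\langle A;\wedge,\vee\rangle$. -/

import Mathlib

universe u v

/-! Brouwerian algebras `⟨A; →, ∧, ∨, ⊤⟩` are Mathlib's `GeneralizedHeytingAlgebra`s. -/

namespace Brouwerian

open FirstOrder FirstOrder.Language

/-! ### The dual space -/

section Dual

variable (A : Type u) [GeneralizedHeytingAlgebra A]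

/-- `Pr A`: the (non-empty, lattice) filters of `A` whose complement is closed under `∨`.
The improper filter `A` is included (so this is not `Order.PFilter.IsPrime`). -/
def PrimeFilter : Type u :=
  {F : Order.PFilter A // ∀ a b : A, a ∉ F → b ∉ F → a ⊔ b ∉ F}

/-- Prime filters are ordered by inclusion. -/
instance : PartialOrder (PrimeFilter A) :=
  inferInstanceAs (PartialOrder {F : Order.PFilter A // ∀ a b : A, a ∉ F → b ∉ F → a ⊔ b ∉ F})

theorem isPFilter_univ : Order.IsPFilter (Set.univ : Set A) :=
  Order.IsPFilter.of_def ⟨⊤, trivial⟩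
    (fun a _ b _ => ⟨a ⊓ b, trivial, inf_le_left, inf_le_right⟩) (fun _ _ => trivial)

/-- The improper filter is the greatest element of the dual space. -/
instance : OrderTop (PrimeFilter A) where
  top := ⟨(isPFilter_univ A).toPFilter, fun _ _ h => (h trivial).elim⟩
  le_top _ := fun _ _ => trivial

/-- The topology on `Pr A` with subbasis the sets `{F | a ∈ F}` and their complements.  Together
with the order and the greatest element this is the dual space of `A`; the depth defined below
only involves the order and the greatest element. -/
instance : TopologicalSpace (PrimeFilter A) :=
  TopologicalSpace.generateFrom
    (Set.range (fun a : A => {F : PrimeFilter A | a ∈ F.1}) ∪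
      Set.range (fun a : A => {F : PrimeFilter A | a ∈ F.1}ᶜ))

end Dual

/-! ### Depth -/

/-- The depth of `p` in a poset: the number of elements in a longest chain `p = p₁ < ⋯ < pₙ`, and
`∞` if there is no longest one.  (`Order.coheight` counts the steps of such chains.) -/
noncomputable def elemDepth {P : Type u} [PartialOrder P] (p : P) : ℕ∞ :=
  Order.coheight p + 1

/-- `p` has depth `n > 0` iff there is a chain `p = p₁ < ⋯ < pₙ` and no chain
`p = q₁ < ⋯ < qₙ < qₙ₊₁` (an `LTSeries` of length `k` has `k + 1` members). -/
theorem elemDepth_eq_iff {P : Type u} [PartialOrder P] (p : P) (n : ℕ) (hn : 0 < n) :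
    elemDepth p = n ↔
      (∃ s : LTSeries P, s.head = p ∧ s.length + 1 = n) ∧
        ¬ ∃ s : LTSeries P, s.head = p ∧ s.length = n := by
  obtain ⟨k, rfl⟩ : ∃ k, n = k + 1 := ⟨n - 1, by omega⟩
  have key : elemDepth p = ((k + 1 : ℕ) : ℕ∞) ↔ Order.coheight p = k := by
    unfold elemDepth
    push_cast
    exact (ENat.add_left_injective_of_ne_top ENat.one_ne_top).eq_iff
  rw [key]
  constructor
  · intro h
    refine ⟨?_, ?_⟩
    · obtain ⟨s, hs, hl⟩ := Order.exists_series_of_coheight_eq_coe p h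
      exact ⟨s, hs, by omega⟩
    · rintro ⟨s, hs, hl⟩
      have := Order.length_le_coheight (x := p) (p := s) hs.ge
      rw [h, hl] at this
      have : k + 1 ≤ k := by exact_mod_cast this
      omega
  · rintro ⟨⟨s, hs, hl⟩, h2⟩
    apply le_antisymm
    · by_contra hc
      have hc' : ((k + 1 : ℕ) : ℕ∞) ≤ Order.coheight p := by
        push_cast
        exact Order.add_one_le_of_lt (not_le.mp hc)
      obtain ⟨t, ht, htl⟩ := Order.exists_series_of_le_coheight p hc'
      exact h2 ⟨t, ht, htl⟩
    · have := Order.length_le_coheight (x := p) (p := s) hs.ge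
      have e : s.length = k := by omega
      rwa [e] at this

open Classical in
/-- The depth of `p` in a pointed space with greatest element `m`: it is `0` if `p = m`, and
otherwise it is the depth of `p` in the poset obtained by removing `m`. -/
noncomputable def pointedElemDepth {X : Type u} [PartialOrder X] [OrderTop X] (p : X) : ℕ∞ :=
  if h : p = ⊤ then 0 else elemDepth (⟨p, h⟩ : {x : X // x ≠ ⊤})

/-- The depth of a pointed space is the supremum of the depths of its elements. -/
noncomputable def spaceDepth (X : Type u) [PartialOrder X] [OrderTop X] : ℕ∞ :=
  ⨆ p : X, pointedElemDepth p

/-- The depth of a Brouwerian algebra is the depth of its dual space. -/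
noncomputable def algDepth (A : Type u) [GeneralizedHeytingAlgebra A] : ℕ∞ :=
  spaceDepth (PrimeFilter A)

/-! ### Signature, terms and equations -/

/-- The operation symbols `→, ∧, ∨, ⊤`. -/
inductive Op : ℕ → Type
  | imp : Op 2
  | inf : Op 2
  | sup : Op 2
  | top : Op 0

/-- The algebraic signature `→, ∧, ∨, ⊤`. -/
def sig : FirstOrder.Language.{0, 0} where
  Functions := Op
  Relations := fun _ => Empty

/-- A Brouwerian algebra as an algebra of the signature `→, ∧, ∨, ⊤`. -/
instance toStructure (A : Type u) [GeneralizedHeytingAlgebra A] : sig.Structure A where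
  funMap {_} f := match f with
    | .imp => fun v => v 0 ⇨ v 1
    | .inf => fun v => v 0 ⊓ v 1
    | .sup => fun v => v 0 ⊔ v 1
    | .top => fun _ => ⊤
  RelMap r := r.elim

/-- Terms in the variables `0, 1, 2, …`. -/
abbrev Tm : Type := sig.Term ℕ

/-- `s → t` -/
def Tm.imp (s t : Tm) : Tm := Functions.apply₂ (L := sig) Op.imp s t
/-- `s ∨ t` -/
def Tm.sup (s t : Tm) : Tm := Functions.apply₂ (L := sig) Op.sup s t
/-- `⊤` -/
def Tm.top : Tm := Constants.term (L := sig) Op.top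

/-- `h₀ = y` and `hₙ = xₙ ∨ (xₙ → hₙ₋₁)` for `n > 0`, where `y` is variable `0` and `xᵢ` is
variable `i` for `i > 0`. -/
def h : ℕ → Tm
  | 0 => Term.var 0
  | n + 1 => Tm.sup (Term.var (n + 1)) (Tm.imp (Term.var (n + 1)) (h n))

/-- The algebra `A` satisfies the equation `s ≈ t`. -/
def Satisfies (A : Type u) [sig.Structure A] (s t : Tm) : Prop :=
  ∀ val : ℕ → A, s.realize val = t.realize val

/-! ### Adding a new least element -/

open Classical in
/-- `A_⊥`: the Heyting algebra whose lattice is that of `A` with a new least element. -/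
noncomputable instance heytingWithBot (A : Type u) [GeneralizedHeytingAlgebra A] :
    HeytingAlgebra (WithBot A) where
  himp
    | ⊥, _ => ⊤
    | (a : A), ⊥ => ⊥
    | (a : A), (b : A) => ((a ⇨ b : A) : WithBot A)
  le_himp_iff a b c := by
    induction b using WithBot.recBotCoe with
    | bot => simp
    | coe b =>
      induction a using WithBot.recBotCoe with
      | bot => simp
      | coe a =>
        induction c using WithBot.recBotCoe with
        | bot => simp [← WithBot.coe_inf]
        | coe c =>
          rw [← WithBot.coe_inf]
          exact (WithBot.coe_le_coe.trans le_himp_iff).trans WithBot.coe_le_coe.symm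
  compl
    | ⊥ => ⊤
    | (_ : A) => ⊥
  himp_bot a := by
    induction a using WithBot.recBotCoe <;> rfl

/-! ### Varieties -/

/-- Algebras of the signature `→, ∧, ∨, ⊤`. -/
abbrev Alg : Type (u + 1) := CategoryTheory.Bundled.{u} sig.Structure

/-- Direct products, with the coordinatewise operations. -/
instance piStructure {ι : Type u} (M : ι → Type v) [∀ i, sig.Structure (M i)] :
    sig.Structure (∀ i, M i) where
  funMap f x := fun i => Structure.funMap f (fun k => x k i)
  RelMap r := r.elim

/-- A variety: a non-empty class of algebras closed under homomorphic images, subalgebras and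
direct products. -/
structure IsVariety (K : Set Alg.{u}) : Prop where
  nonempty : K.Nonempty
  homImage : ∀ M N : Alg.{u}, M ∈ K → ∀ f : M →[sig] N, Function.Surjective f → N ∈ K
  subalgebra : ∀ M : Alg.{u}, M ∈ K → ∀ S : sig.Substructure M,
    (CategoryTheory.Bundled.of S : Alg.{u}) ∈ K
  prod : ∀ (ι : Type u) (M : ι → Alg.{u}), (∀ i, M i ∈ K) →
    (CategoryTheory.Bundled.of (∀ i, M i) : Alg.{u}) ∈ K

/-- An equational class: all algebras that satisfy a given set of equations. -/
def IsEquationalClass (K : Set Alg.{u}) : Prop :=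
  ∃ E : Set (Tm × Tm), K = {M : Alg.{u} | ∀ e ∈ E, Satisfies M e.1 e.2}

/-- `BRAₙ`: the class of all Brouwerian algebras of depth at most `n`, as a class of algebras of
the signature `→, ∧, ∨, ⊤`. -/
def BRA (n : ℕ) : Set Alg.{u} :=
  {M | ∃ inst : GeneralizedHeytingAlgebra M, M.str = @toStructure M inst ∧ @algDepth M inst ≤ n}

end Brouwerian

/-! The depth bound holds pointwise: a prime filter `F` has coheight at most `n` in `Pr A` iff every
value of `h n` lies in `F` (`coheight_le_iff_hVal_mem`). The proof is by induction on `n`. If `x ∨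
(x → t)` is not in `F`, the prime filter theorem extends the filter generated by `F` and `x` to a
prime `G` omitting `t`, and `G` is strictly above `F` since `x ∉ F`. Conversely, for `G` strictly
above `F`, substituting some `a ∈ G \ F` for the last variable puts `a → t` in `F`, so `t ∈ G` by
modus ponens. An element is `⊤` iff it lies in all prime filters, so quantifying over `F` gives the
first claim.

Brouwerian algebras have an equational basis; adding `h n ≈ ⊤` axiomatizes `BRA n`, and equational
classes are varieties.

The third claim is a computation in `A_⊥`: when `y = ⊥` and `x₁ ≠ ⊥`, the term `h 1` takes the value
`x₁`, which shifts the indices by one. -/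

namespace Brouwerian

open FirstOrder FirstOrder.Language

/-! ### Semantics of the terms `h n` -/

section Realize

variable {A : Type u} [GeneralizedHeytingAlgebra A] (val : ℕ → A)

/-- The value of the term `h n` under a valuation. -/
def hVal : ℕ → A
  | 0 => val 0
  | n + 1 => val (n + 1) ⊔ (val (n + 1) ⇨ hVal n)

theorem realize_imp (s t : Tm) : (s.imp t).realize val = s.realize val ⇨ t.realize val :=
  Term.realize_functions_apply₂ (L := sig)

theorem realize_sup (s t : Tm) : (s.sup t).realize val = s.realize val ⊔ t.realize val :=
  Term.realize_functions_apply₂ (L := sig)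

theorem realize_top : Tm.top.realize val = ⊤ := rfl

theorem realize_h (n : ℕ) : (h n).realize val = hVal val n := by
  induction n with
  | zero => rfl
  | succ n ih => rw [h, realize_sup, realize_imp, ih]; rfl

theorem satisfies_h_iff (A : Type u) [GeneralizedHeytingAlgebra A] (n : ℕ) :
    Satisfies A (h n) Tm.top ↔ ∀ val : ℕ → A, hVal val n = ⊤ :=
  forall_congr' fun val => by rw [realize_h, realize_top]

end Realize

/-! ### Prime filters -/

section PrimeFilter

variable {A : Type u} [GeneralizedHeytingAlgebra A]

theorem mem_of_himp_mem {F : Order.PFilter A} {a b : A} (hab : a ⇨ b ∈ F) (ha : a ∈ F) : b ∈ F :=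
  F.mem_of_le himp_inf_le (Order.PFilter.inf_mem hab ha)

theorem PrimeFilter.sup_mem_iff (F : PrimeFilter A) {a b : A} :
    a ⊔ b ∈ F.1 ↔ a ∈ F.1 ∨ b ∈ F.1 := by
  refine ⟨fun hab => ?_, ?_⟩
  · by_contra! hc
    exact F.2 a b hc.1 hc.2 hab
  · rintro (ha | hb)
    · exact F.1.mem_of_le le_sup_left ha
    · exact F.1.mem_of_le le_sup_right hb

theorem PrimeFilter.eq_top_iff (F : PrimeFilter A) : F = ⊤ ↔ ∀ a : A, a ∈ F.1 := by
  refine ⟨?_, fun hF => le_antisymm le_top fun a _ => hF a⟩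
  rintro rfl a
  exact trivial

/-- The filter of all `b` with `a ⇨ b ∈ F`; it is generated by `F` and `a`. -/
def adjoin (F : Order.PFilter A) (a : A) : Order.PFilter A :=
  (Order.IsPFilter.of_def (F := {b | a ⇨ b ∈ F})
    ⟨⊤, by simp only [Set.mem_ofPred_eq, himp_top]; exact F.top_mem⟩
    (fun b hb c hc => ⟨b ⊓ c, by
      simp only [Set.mem_ofPred_eq, himp_inf_distrib]
      exact Order.PFilter.inf_mem hb hc, inf_le_left, inf_le_right⟩)
    (fun hbc hb => F.mem_of_le (himp_le_himp_left hbc) hb)).toPFilter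

theorem mem_adjoin {F : Order.PFilter A} {a b : A} : b ∈ adjoin F a ↔ a ⇨ b ∈ F := Iff.rfl

theorem le_adjoin (F : Order.PFilter A) (a : A) : F ≤ adjoin F a :=
  fun _ hb => F.mem_of_le le_himp hb

theorem self_mem_adjoin (F : Order.PFilter A) (a : A) : a ∈ adjoin F a := by
  rw [mem_adjoin, himp_self]
  exact F.top_mem

/-- The union of a nonempty chain of filters. -/
theorem exists_pFilter_eq_iUnion {c : Set (Order.PFilter A)} (hc : IsChain (· ≤ ·) c)
    (hne : c.Nonempty) : ∃ G : Order.PFilter A, ∀ a, a ∈ G ↔ ∃ F ∈ c, a ∈ F := by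
  refine ⟨(Order.IsPFilter.of_def (F := {a | ∃ F ∈ c, a ∈ F}) ?_ ?_ ?_).toPFilter,
    fun a => Iff.rfl⟩
  · obtain ⟨F, hF⟩ := hne
    exact ⟨⊤, F, hF, F.top_mem⟩
  · rintro a ⟨F, hF, ha⟩ b ⟨G, hG, hb⟩
    refine ⟨a ⊓ b, ?_, inf_le_left, inf_le_right⟩
    rcases hc.total hF hG with hFG | hGF
    · exact ⟨G, hG, Order.PFilter.inf_mem (hFG ha) hb⟩
    · exact ⟨F, hF, Order.PFilter.inf_mem ha (hGF hb)⟩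
  · rintro a b hab ⟨F, hF, ha⟩
    exact ⟨F, hF, F.mem_of_le hab ha⟩

/-- The prime filter theorem. -/
theorem exists_primeFilter_notMem (F : Order.PFilter A) {b : A} (hb : b ∉ F) :
    ∃ G : PrimeFilter A, F ≤ G.1 ∧ b ∉ G.1 := by
  obtain ⟨G, hFG, hG⟩ := zorn_le_nonempty₀ {G : Order.PFilter A | b ∉ G} (by
    intro c hcb hc F₀ hF₀
    obtain ⟨G, hG⟩ := exists_pFilter_eq_iUnion hc ⟨F₀, hF₀⟩
    refine ⟨G, ?_, fun F hF a ha => (hG a).2 ⟨F, hF, ha⟩⟩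
    rw [Set.mem_ofPred_eq, hG]
    rintro ⟨F, hF, hbF⟩
    exact hcb hF hbF) F hb
  -- By maximality of `G`, the strictly larger filter generated by `G` and `a` must contain `b`.
  have key : ∀ a, a ∉ G → a ⇨ b ∈ G := by
    intro a ha
    by_contra hab
    exact ha (hG.le_of_ge (y := adjoin G a) hab (le_adjoin G a) (self_mem_adjoin G a))
  refine ⟨⟨G, fun c d hc hd hcd => hG.prop (mem_of_himp_mem ?_ hcd)⟩, hFG, hG.prop⟩
  rw [sup_himp_distrib]
  exact Order.PFilter.inf_mem (key c hc) (key d hd)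

theorem eq_top_iff_forall_mem_primeFilter (a : A) :
    a = ⊤ ↔ ∀ F : PrimeFilter A, a ∈ F.1 := by
  refine ⟨?_, fun ha => ?_⟩
  · rintro rfl F
    exact F.1.top_mem
  · by_contra hne
    obtain ⟨G, -, hG⟩ := exists_primeFilter_notMem (Order.PFilter.principal (⊤ : A)) (b := a)
      (by rwa [Order.PFilter.mem_principal, top_le_iff])
    exact hG (ha G)

theorem coheight_le_iff_hVal_mem (n : ℕ) (F : PrimeFilter A) :
    Order.coheight F ≤ n ↔ ∀ val : ℕ → A, hVal val n ∈ F.1 := by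
  induction n generalizing F with
  | zero =>
    rw [Nat.cast_zero, nonpos_iff_eq_zero, Order.coheight_eq_zero, isMax_iff_eq_top,
      F.eq_top_iff]
    -- `h 0` is a variable, so its values exhaust `A`.
    exact ⟨fun hF val => hF _, fun hF a => hF fun _ => a⟩
  | succ n ih =>
    have hlt : ∀ G : PrimeFilter A,
        Order.coheight G < ((n + 1 : ℕ) : ℕ∞) ↔ Order.coheight G ≤ n := fun G => by
      push_cast
      exact ENat.lt_natCast_add_one_iff
    simp only [Order.coheight_le_coe_iff, hlt, ih]
    constructor
    · intro hF val
      rw [hVal, F.sup_mem_iff]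
      by_contra! hc
      obtain ⟨G, hFG, hG⟩ := exists_primeFilter_notMem (adjoin F.1 (val (n + 1))) hc.2
      have hx := hFG (self_mem_adjoin F.1 (val (n + 1)))
      have hle : F ≤ G := (le_adjoin F.1 (val (n + 1))).trans hFG
      exact hG (hF G (lt_of_le_not_ge hle fun hGF => hc.1 (hGF hx)) val)
    · intro hF G hFG val
      obtain ⟨a, haG, haF⟩ : ∃ a, a ∈ G.1 ∧ a ∉ F.1 := by
        by_contra! hc
        exact hFG.not_ge fun a ha => hc a ha
      -- The variable `n + 1` does not occur in `h m` for `m ≤ n`.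
      have hval : ∀ m, m ≤ n → hVal (Function.update val (n + 1) a) m = hVal val m := by
        intro m hm
        induction m with
        | zero => simp [hVal]
        | succ m ihm => simp [hVal, ihm (by omega), show m ≠ n by omega]
      have hmem := hF (Function.update val (n + 1) a)
      rw [hVal, hval n le_rfl, Function.update_self, F.sup_mem_iff] at hmem
      exact mem_of_himp_mem (hFG.le (hmem.resolve_left haF)) haG

end PrimeFilter

/-! ### Depth -/

/-- Counting the members of chains that avoid `⊤` amounts to counting the steps of the same chains
prolonged to `⊤`. -/
theorem pointedElemDepth_le_iff_coheight_le {X : Type u} [PartialOrder X] [OrderTop X] (n : ℕ)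
    (p : X) : pointedElemDepth p ≤ n ↔ Order.coheight p ≤ n := by
  induction n generalizing p with
  | zero =>
    rw [Nat.cast_zero, nonpos_iff_eq_zero, nonpos_iff_eq_zero, Order.coheight_eq_zero,
      isMax_iff_eq_top, pointedElemDepth]
    split_ifs with hp <;> simp [hp, elemDepth]
  | succ n ih =>
    by_cases hp : p = ⊤
    · simp [pointedElemDepth, hp]
    rw [Order.coheight_le_coe_iff, pointedElemDepth, dif_neg hp, elemDepth, Nat.cast_succ,
      ENat.add_le_add_iff_right ENat.one_ne_top, Order.coheight_le_coe_iff]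
    simp only [ENat.lt_natCast_add_one_iff, ← ih]
    constructor
    · intro hlt y hy
      rw [pointedElemDepth]
      split_ifs with hy'
      · exact zero_le
      · exact Order.add_one_le_of_lt (hlt ⟨y, hy'⟩ hy)
    · intro hle y hy
      have := hle y hy
      rw [pointedElemDepth, dif_neg y.2, elemDepth] at this
      exact (ENat.add_lt_add_iff_right ENat.one_ne_top).1 (ENat.lt_natCast_add_one_iff.2 this)

theorem algDepth_le_iff_satisfies_h (n : ℕ) (A : Type u) [GeneralizedHeytingAlgebra A] :
    algDepth A ≤ (n : ℕ∞) ↔ Satisfies A (h n) Tm.top := by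
  simp only [algDepth, spaceDepth, iSup_le_iff, pointedElemDepth_le_iff_coheight_le,
    coheight_le_iff_hVal_mem, satisfies_h_iff, eq_top_iff_forall_mem_primeFilter]
  exact forall_comm

/-! ### Adding a least element -/

section WithBot

variable {A : Type u} [GeneralizedHeytingAlgebra A]

theorem coe_himp_coe (a b : A) : (a : WithBot A) ⇨ (b : WithBot A) = ((a ⇨ b : A) : WithBot A) :=
  rfl

theorem coe_himp_bot (a : A) : (a : WithBot A) ⇨ ⊥ = ⊥ := rfl

/-- As `x → ⊥ = ⊥` for `x ≠ ⊥`, the value of `h 1` is that of `x₁`, which then plays the role of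
`y`. -/
theorem hVal_succ_of_bot (v : ℕ → WithBot A) (hv : v 0 = ⊥) (val : ℕ → A) (n : ℕ)
    (hval : ∀ i ≤ n, v (i + 1) = val i) :
    hVal v (n + 1) = ((hVal val n : A) : WithBot A) := by
  induction n with
  | zero =>
    change v (0 + 1) ⊔ (v (0 + 1) ⇨ v 0) = val 0
    rw [hval 0 le_rfl, hv, coe_himp_bot, sup_bot_eq]
  | succ n ih =>
    rw [hVal, ih fun i hi => hval i (by omega), hval (n + 1) le_rfl, coe_himp_coe]
    rfl

theorem hVal_eq_top_of_le {B : Type u} [GeneralizedHeytingAlgebra B] (v : ℕ → B) {m n : ℕ}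
    (hmn : m ≤ n) (hm : hVal v m = ⊤) : hVal v n = ⊤ := by
  induction n, hmn using Nat.le_induction with
  | base => exact hm
  | succ n _ ih => rw [hVal, ih, himp_top, sup_top_eq]

theorem satisfies_h_iff_withBot (n : ℕ) (A : Type u) [GeneralizedHeytingAlgebra A] :
    Satisfies A (h n) Tm.top ↔ Satisfies (WithBot A) (h (n + 1)) Tm.top := by
  rw [satisfies_h_iff, satisfies_h_iff]
  constructor
  · intro hA v
    by_cases hbot : ∃ i ≤ n, v (i + 1) = ⊥
    -- A variable `x` with value `⊥` makes its own layer `⊤`, because `⊥ → t = ⊤`, and all later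
    -- layers stay `⊤`.
    · obtain ⟨i, hi, hvi⟩ := hbot
      refine hVal_eq_top_of_le v (Nat.succ_le_succ hi) ?_
      rw [hVal, hvi, bot_himp, sup_top_eq]
    push Not at hbot
    have hex : ∀ i, ∃ a : A, i ≤ n → v (i + 1) = a := fun i => by
      by_cases hi : i ≤ n
      · obtain ⟨a, ha⟩ := WithBot.ne_bot_iff_exists.1 (hbot i hi)
        exact ⟨a, fun _ => ha.symm⟩
      · exact ⟨⊤, fun hi' => absurd hi' hi⟩
    choose val hval using hex
    by_cases h0 : v 0 = ⊥
    · rw [hVal_succ_of_bot v h0 val n hval, hA]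
      rfl
    obtain ⟨b, hb⟩ := WithBot.ne_bot_iff_exists.1 h0
    -- With no relevant value equal to `⊥`, everything is computed inside `A`, where `h n` is
    -- already `⊤`.
    refine hVal_eq_top_of_le v (Nat.le_succ n) ?_
    have hcongr : ∀ m ≤ n, hVal v m = ((hVal (fun i => Nat.casesOn i b val) m : A) : WithBot A) := by
      intro m hm
      induction m with
      | zero => exact hb.symm
      | succ m ih =>
        rw [hVal, ih (by omega), hval m (by omega), coe_himp_coe]
        rfl
    rw [hcongr n le_rfl, hA]
    rfl
  · intro hA val
    have := hA fun i => Nat.casesOn i ⊥ fun j => (val j : WithBot A)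
    rw [hVal_succ_of_bot _ rfl val n fun _ _ => rfl] at this
    exact WithBot.coe_injective this

end WithBot

/-! ### Equational classes are varieties -/

theorem Satisfies.homImage {M N : Alg.{u}} {s t : Tm} (hM : Satisfies M s t) (f : M →[sig] N)
    (hf : Function.Surjective f) : Satisfies N s t := by
  intro val
  -- Surjectivity lifts each valuation in `N` to one in `M`.
  have hval : val = f ∘ (Function.surjInv hf ∘ val) :=
    funext fun i => (Function.surjInv_eq hf (val i)).symm
  rw [hval, HomClass.realize_term, HomClass.realize_term, hM]

theorem Satisfies.substructure {M : Type u} [sig.Structure M] {s t : Tm} (hM : Satisfies M s t)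
    (S : sig.Substructure M) : Satisfies S s t := by
  intro val
  apply S.subtype.injective
  rw [← HomClass.realize_term, ← HomClass.realize_term, hM]

/-- The projections of a direct product. -/
def piProj {ι : Type u} (M : ι → Type u) [∀ i, sig.Structure (M i)] (i : ι) :
    (∀ i, M i) →[sig] M i where
  toFun x := x i
  map_fun' _ _ := rfl
  map_rel' r := r.elim

theorem Satisfies.pi {ι : Type u} {M : ι → Type u} [∀ i, sig.Structure (M i)] {s t : Tm}
    (hM : ∀ i, Satisfies (M i) s t) : Satisfies (∀ i, M i) s t := by
  intro val
  funext i
  change piProj M i _ = piProj M i _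
  rw [← HomClass.realize_term, ← HomClass.realize_term, hM i]

theorem IsEquationalClass.isVariety {K : Set Alg.{u}} (hK : IsEquationalClass K) :
    IsVariety K := by
  obtain ⟨E, rfl⟩ := hK
  refine ⟨?_, fun M N hM f hf e he => (hM e he).homImage f hf,
    fun M hM S e he => Satisfies.substructure (M := M) (hM e he) S,
    fun ι M hM e he => Satisfies.pi fun i => hM i e he⟩
  -- The one-element algebra satisfies every equation.
  exact ⟨⟨PUnit, { funMap := fun _ _ => PUnit.unit, RelMap := fun r => r.elim }⟩,
    fun e _ val => Subsingleton.elim (α := PUnit) _ _⟩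

/-! ### Equations for Brouwerian algebras -/

/-- `s ∧ t` -/
def Tm.inf (s t : Tm) : Tm := Functions.apply₂ (L := sig) Op.inf s t

/-- An equational basis for the Brouwerian algebras. -/
def brouwerianEquations : Set (Tm × Tm) :=
  let x : Tm := Term.var 0
  let y : Tm := Term.var 1
  let z : Tm := Term.var 2
  {(x.sup y, y.sup x), ((x.sup y).sup z, x.sup (y.sup z)), (x.inf y, y.inf x),
    ((x.inf y).inf z, x.inf (y.inf z)), (x.sup (x.inf y), x), (x.inf (x.sup y), x),
    (x.imp x, Tm.top), (x.inf (x.imp y), x.inf y), (y.inf (x.imp y), y),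
    (x.imp (y.inf z), (x.imp y).inf (x.imp z))}

/-- An algebra with the operations of a Brouwerian algebra that satisfies the defining
equations is a Brouwerian algebra. -/
abbrev brouwerianOfEquations {A : Type u} (imp inf sup : A → A → A) (top : A)
    (sup_comm : ∀ a b, sup a b = sup b a) (sup_assoc : ∀ a b c, sup (sup a b) c = sup a (sup b c))
    (inf_comm : ∀ a b, inf a b = inf b a) (inf_assoc : ∀ a b c, inf (inf a b) c = inf a (inf b c))
    (sup_inf_self : ∀ a b, sup a (inf a b) = a) (inf_sup_self : ∀ a b, inf a (sup a b) = a)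
    (imp_self : ∀ a, imp a a = top) (inf_imp : ∀ a b, inf a (imp a b) = inf a b)
    (inf_imp_right : ∀ a b, inf b (imp a b) = b)
    (imp_inf : ∀ a b c, imp a (inf b c) = inf (imp a b) (imp a c)) :
    GeneralizedHeytingAlgebra A :=
  letI : Max A := ⟨sup⟩
  letI : Min A := ⟨inf⟩
  letI L : Lattice A := Lattice.mk' sup_comm sup_assoc inf_comm inf_assoc sup_inf_self inf_sup_self
  have le_iff : ∀ a b : A, a ≤ b ↔ inf a b = a := fun a b => (inf_eq_left (a := a) (b := b)).symm
  have idem : ∀ a : A, inf a a = a := fun a => inf_idem (a := a)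
  have le_top' : ∀ a : A, a ≤ top := fun a => by
    rw [le_iff, ← imp_self a, inf_imp, idem]
  have imp_mono : ∀ a b c : A, b ≤ c → imp a b ≤ imp a c := fun a b c hbc => by
    rw [le_iff] at hbc ⊢
    rw [← imp_inf, hbc]
  { L with
    top := top
    le_top := le_top'
    himp := imp
    le_himp_iff := fun a b c => by
      change a ≤ imp b c ↔ a ⊓ b ≤ c
      constructor
      · intro hab
        have h1 : a ⊓ b ≤ b ⊓ imp b c := le_inf inf_le_right (inf_le_left.trans hab)
        have h2 : b ⊓ imp b c = b ⊓ c := inf_imp b c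
        exact (h1.trans h2.le).trans inf_le_right
      · intro hab
        -- The chain is `a ≤ b → a = b → (a ∧ b) ≤ b → c`.
        have h1 : a ≤ imp b a := (le_iff _ _).2 (inf_imp_right b a)
        have h2 : imp b (inf a b) = imp b a := by
          rw [imp_inf, imp_self, ← le_iff]
          exact le_top' _
        exact (h1.trans h2.ge).trans (imp_mono b _ c hab) }

theorem satisfies_brouwerianEquations (A : Type u) [GeneralizedHeytingAlgebra A] :
    ∀ e ∈ brouwerianEquations, Satisfies A e.1 e.2 := by
  have realize_inf : ∀ (val : ℕ → A) (s t : Tm),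
      (s.inf t).realize val = s.realize val ⊓ t.realize val :=
    fun val s t => Term.realize_functions_apply₂ (L := sig)
  intro e he val
  simp only [brouwerianEquations, Set.mem_insert_iff, Set.mem_singleton_iff] at he
  rcases he with rfl | rfl | rfl | rfl | rfl | rfl | rfl | rfl | rfl | rfl <;>
    simp only [realize_inf, realize_sup, realize_imp, realize_top]
  · exact sup_comm _ _
  · exact sup_assoc _ _ _
  · exact inf_comm _ _
  · exact inf_assoc _ _ _
  · exact sup_inf_self
  · exact inf_sup_self
  · exact himp_self
  · exact inf_himp _ _
  · exact inf_eq_left.2 le_himp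
  · exact himp_inf_distrib _ _ _

theorem exists_brouwerian_of_satisfies {A : Type u} (str : sig.Structure A)
    (hA : ∀ e ∈ brouwerianEquations, Satisfies A e.1 e.2) :
    ∃ inst : GeneralizedHeytingAlgebra A, str = @toStructure A inst := by
  have hi : ∀ (s t : Tm) (val : ℕ → A), (s.imp t).realize val =
      Structure.funMap (L := sig) Op.imp ![s.realize val, t.realize val] :=
    fun s t val => Term.realize_functions_apply₂ (L := sig)
  have hf : ∀ (s t : Tm) (val : ℕ → A), (s.inf t).realize val =
      Structure.funMap (L := sig) Op.inf ![s.realize val, t.realize val] :=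
    fun s t val => Term.realize_functions_apply₂ (L := sig)
  have hs : ∀ (s t : Tm) (val : ℕ → A), (s.sup t).realize val =
      Structure.funMap (L := sig) Op.sup ![s.realize val, t.realize val] :=
    fun s t val => Term.realize_functions_apply₂ (L := sig)
  have ht : ∀ val : ℕ → A, Tm.top.realize val = Structure.funMap (L := sig) Op.top ![] :=
    fun val => congrArg (Structure.funMap (L := sig) Op.top) (Subsingleton.elim _ _)
  simp only [brouwerianEquations, Set.mem_insert_iff, Set.mem_singleton_iff, forall_eq_or_imp,
    forall_eq, Satisfies, hi, hf, hs, ht, Term.realize_var] at hA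
  obtain ⟨h1, h2, h3, h4, h5, h6, h7, h8, h9, h10⟩ := hA
  -- Variables `0` and `1` take the values `a` and `b`, all others `c`; equations in fewer variables
  -- get a filler.
  let v (a b c : A) : ℕ → A := fun i => Nat.casesOn i a fun j => Nat.casesOn j b fun _ => c
  refine ⟨brouwerianOfEquations
    (fun a b => Structure.funMap (L := sig) Op.imp ![a, b])
    (fun a b => Structure.funMap (L := sig) Op.inf ![a, b])
    (fun a b => Structure.funMap (L := sig) Op.sup ![a, b])
    (Structure.funMap (L := sig) Op.top ![])
    (fun a b => h1 (v a b a)) (fun a b c => h2 (v a b c)) (fun a b => h3 (v a b a))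
    (fun a b c => h4 (v a b c)) (fun a b => h5 (v a b a)) (fun a b => h6 (v a b a))
    (fun a => h7 (v a a a)) (fun a b => h8 (v a b a)) (fun a b => h9 (v a b a))
    (fun a b c => h10 (v a b c)), ?_⟩
  -- The rebuilt operations see only explicit pairs, so agreement with `str` requires writing each
  -- argument vector as one.
  have hv : ∀ w : Fin 2 → A, w = ![w 0, w 1] := fun w => by
    ext i
    fin_cases i <;> rfl
  refine Structure.ext ?_ ?_
  · funext n f w
    cases f with
    | imp => exact congrArg (Structure.funMap (L := sig) Op.imp) (hv w)
    | inf => exact congrArg (Structure.funMap (L := sig) Op.inf) (hv w)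
    | sup => exact congrArg (Structure.funMap (L := sig) Op.sup) (hv w)
    | top => exact congrArg (Structure.funMap (L := sig) Op.top) (Subsingleton.elim _ _)
  · funext n r
    exact r.elim

theorem isEquationalClass_BRA (n : ℕ) : IsEquationalClass (BRA.{u} n) := by
  refine ⟨insert (h n, Tm.top) brouwerianEquations, Set.ext fun ⟨A, str⟩ => ?_⟩
  constructor
  · change (∃ inst : GeneralizedHeytingAlgebra A,
      str = @toStructure A inst ∧ @algDepth A inst ≤ n) → _
    rintro ⟨inst, rfl, hd⟩
    rw [Set.mem_ofPred_eq, Set.forall_mem_insert]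
    exact ⟨(algDepth_le_iff_satisfies_h n A).1 hd, satisfies_brouwerianEquations A⟩
  · intro hA
    rw [Set.mem_ofPred_eq, Set.forall_mem_insert] at hA
    obtain ⟨inst, rfl⟩ := exists_brouwerian_of_satisfies str hA.2
    exact ⟨inst, rfl, (algDepth_le_iff_satisfies_h n A).2 hA.1⟩

end Brouwerian

theorem mainTheorem12 :
    (∀ (n : ℕ) (A : Type u) [GeneralizedHeytingAlgebra A],
      Brouwerian.algDepth A ≤ (n : ℕ∞) ↔
        Brouwerian.Satisfies A (Brouwerian.h n) Brouwerian.Tm.top) ∧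
    (∀ n : ℕ, Brouwerian.IsVariety (Brouwerian.BRA.{u} n) ∧
      Brouwerian.IsEquationalClass (Brouwerian.BRA.{u} n)) ∧
    (∀ (n : ℕ) (A : Type u) [GeneralizedHeytingAlgebra A],
      Brouwerian.Satisfies A (Brouwerian.h n) Brouwerian.Tm.top ↔
        Brouwerian.Satisfies (WithBot A) (Brouwerian.h (n + 1)) Brouwerian.Tm.top) := by
  exact ⟨Brouwerian.algDepth_le_iff_satisfies_h,
    fun n => ⟨(Brouwerian.isEquationalClass_BRA n).isVariety, Brouwerian.isEquationalClass_BRA n⟩,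
    Brouwerian.satisfies_h_iff_withBot⟩
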